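/- Let $d\ge 2$, let $f\in\mathbb C[x_1,\ldots,x_d]$, and let $r_1,\ldots,r_d\in\mathbb C(x)$ be non-zero univariate rational functions such that, as an identity in the field $\mathbb C(x_1,\ldots,x_d)$ of rational functions, $$\frac{\frac{\partial f}{\partial x_1}(x_1,\ldots,x_d)}{r_1(x_1)}=\cdots=\frac{\frac{\partial f}{\partial x_d}(x_1,\ldots,x_d)}{r_d(x_d)}.$$ Then there exists an entire function $H:\mathbb C\to\mathbb C$ such that $$f(\gamma_1(1),\ldots,\gamma_d(1))=H\Big(\int_{\gamma_1}r_1+\cdots+\int_{\gamma_d}r_d\Big)$$ for all continuously differentiable (in particular, for all smooth) curves $\gamma_1,\ldots,\gamma_d:[0,1]\to\mathbb C$ such that, for every $i$, $\gamma_i(0)=0$ and the image of $\gamma_i$ contains no pole of $r_i$. Here $\int_{\gamma}r=\int_0^1 r(\gamma(t))\,\gamma'(t)\,dt$. -/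

import Mathlib

open scoped ContDiff unitInterval

noncomputable section

/-- The univariate rational function `r`, read as the rational function `r(x_i)` in the `d`
variables `x_1, …, x_d`, that is, as an element of `ℂ(x_1, …, x_d)`. -/
def ratInVar {d : ℕ} (r : RatFunc ℂ) (i : Fin d) : FractionRing (MvPolynomial (Fin d) ℂ) :=
  r.eval (algebraMap ℂ (FractionRing (MvPolynomial (Fin d) ℂ)))
    (algebraMap (MvPolynomial (Fin d) ℂ) (FractionRing (MvPolynomial (Fin d) ℂ))
      (MvPolynomial.X i))

/-- The quotient `(∂f/∂x_i)(x_1, …, x_d) / r(x_i)` in the field `ℂ(x_1, …, x_d)`. -/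
def partialQuot {d : ℕ} (f : MvPolynomial (Fin d) ℂ) (r : RatFunc ℂ) (i : Fin d) :
    FractionRing (MvPolynomial (Fin d) ℂ) :=
  algebraMap (MvPolynomial (Fin d) ℂ) (FractionRing (MvPolynomial (Fin d) ℂ))
    (MvPolynomial.pderiv i f) / ratInVar r i

/-- `a` is a pole of `r`: it is a root of the denominator of `r` in lowest terms. -/
def IsPole (r : RatFunc ℂ) (a : ℂ) : Prop :=
  r.denom.IsRoot a

/-- The 1-form `r(z) dz`, i.e. `v ↦ r(z) * v` at each point `z` that is not a pole of `r`. -/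
def ratForm (r : RatFunc ℂ) (z : ℂ) : ℂ →L[ℂ] ℂ :=
  r.eval (RingHom.id ℂ) z • ContinuousLinearMap.id ℂ ℂ

end

namespace MvPolynomial

/-! Write `r_i = p_i / q_i` and let `D h` be the common value of the quotients `q_i ∂_i h / p_i`.
The point is that `D` maps the finite-dimensional space `equalQuotients p q N` to itself
(`exists_quotient_mem_equalQuotients`). Along the curves, every `h` in this space satisfies `d/dt
h(γ) = (∑ r_i(γ_i) γ_i') (D h)(γ)`. The values of a basis thus solve a linear system `F' = s' A F`
with constant matrix `A`, so `F 1 = exp (s 1 • A) (F 0)`. This is entire in `s 1`, the sum of the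
integrals, and `f` is a fixed linear combination of the basis. -/

theorem degreeOf_aeval_X_of_ne {ι R : Type*} [CommSemiring R] {i j : ι} (h : i ≠ j)
    (p : Polynomial R) : degreeOf i (Polynomial.aeval (X j : MvPolynomial ι R) p) = 0 := by
  rw [Polynomial.aeval_eq_sum_range]
  refine Nat.le_zero.mp ((degreeOf_sum_le _ _ _).trans (Finset.sup_le fun k _ => ?_))
  rw [smul_eq_C_mul]
  exact (degreeOf_C_mul_le _ _ _).trans (degreeOf_X_pow_of_ne k h).le

theorem aeval_X_ne_zero {ι R : Type*} [CommRing R] (i : ι) {p : Polynomial R}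
    (hp : p ≠ 0) : Polynomial.aeval (X i : MvPolynomial ι R) p ≠ 0 := fun h =>
  hp ((transcendental_iff.mp (transcendental_X R i)) p h)

theorem pderiv_aeval_X_of_ne {ι R : Type*} [CommSemiring R] {i j : ι} (h : i ≠ j)
    (p : Polynomial R) : pderiv i (Polynomial.aeval (X j : MvPolynomial ι R) p) = 0 :=
  pderiv_eq_zero_of_notMem_vars fun hi =>
    mem_vars_iff_degreeOf_ne_zero.mp hi (degreeOf_aeval_X_of_ne h p)

theorem degreeOf_pderiv_le {ι R : Type*} [CommSemiring R] (i j : ι) (f : MvPolynomial ι R) :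
    degreeOf i (pderiv j f) ≤ degreeOf i f := by
  classical
  rw [degreeOf_le_iff]
  intro m hm
  rw [mem_support_iff, coeff_pderiv] at hm
  have h : m + Finsupp.single j 1 ∈ f.support := by
    rw [mem_support_iff]
    intro h0
    exact hm (by rw [h0]; simp)
  refine le_trans ?_ (monomial_le_degreeOf i h)
  simp

theorem pderiv_comm {ι R : Type*} [CommSemiring R] (i j : ι) (f : MvPolynomial ι R) :
    pderiv i (pderiv j f) = pderiv j (pderiv i f) := by
  classical
  ext m
  rcases eq_or_ne i j with rfl | h
  · rfl
  · simp [coeff_pderiv, add_right_comm, h, h.symm]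
    ring

theorem degreeOf_le_of_dvd {ι R : Type*} [CommRing R] [IsDomain R] {p q : MvPolynomial ι R}
    (h : p ∣ q) (hq : q ≠ 0) (i : ι) : degreeOf i p ≤ degreeOf i q := by
  obtain ⟨c, rfl⟩ := h
  rw [degreeOf_mul_eq (left_ne_zero_of_mul hq) (right_ne_zero_of_mul hq)]
  exact Nat.le_add_right _ _

/-- A common divisor has degree zero in every variable, hence is a nonzero constant. -/
theorem isRelPrime_aeval_X {ι K : Type*} [Field K] {i j : ι} (h : i ≠ j) {p q : Polynomial K}
    (hp : p ≠ 0) (hq : q ≠ 0) :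
    IsRelPrime (Polynomial.aeval (X i : MvPolynomial ι K) p)
      (Polynomial.aeval (X j : MvPolynomial ι K) q) := by
  intro c hcp hcq
  have hv : c.vars = ∅ := by
    refine Finset.eq_empty_of_forall_notMem fun k hk => mem_vars_iff_degreeOf_ne_zero.mp hk ?_
    by_cases hki : k = i
    · subst hki
      exact Nat.le_zero.mp ((degreeOf_le_of_dvd hcq (aeval_X_ne_zero j hq) k).trans
        (degreeOf_aeval_X_of_ne h q).le)
    · exact Nat.le_zero.mp ((degreeOf_le_of_dvd hcp (aeval_X_ne_zero i hp) k).trans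
        (degreeOf_aeval_X_of_ne hki p).le)
  have hc0 : c ≠ 0 := ne_zero_of_dvd_ne_zero (aeval_X_ne_zero i hp) hcp
  rw [vars_eq_empty_iff_eq_C] at hv
  rw [hv] at hc0 ⊢
  exact (isUnit_iff_ne_zero.mpr fun h0 => hc0 (by rw [h0, C_0])).map C

end MvPolynomial

open MvPolynomial

/-- The polynomials `h` of degree at most `N` in each variable for which all the quotients
`(∂h/∂x_i) q_i(x_i) / p_i(x_i)` coincide. -/
def equalQuotients {ι K : Type*} [Field K] (p q : ι → Polynomial K) (N : ℕ) :
    Submodule K (MvPolynomial ι K) where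
  carrier := {h | (∀ i, degreeOf i h ≤ N) ∧ ∀ i j,
    Polynomial.aeval (X i : MvPolynomial ι K) (q i) * pderiv i h *
        Polynomial.aeval (X j : MvPolynomial ι K) (p j) =
      Polynomial.aeval (X j : MvPolynomial ι K) (q j) * pderiv j h *
        Polynomial.aeval (X i : MvPolynomial ι K) (p i)}
  add_mem' := fun {a b} ha hb => ⟨fun i =>
    (degreeOf_add_le i a b).trans (max_le (ha.1 i) (hb.1 i)), fun i j => by
      simp only [map_add, mul_add, add_mul, ha.2 i j, hb.2 i j]⟩
  zero_mem' := by simp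
  smul_mem' := fun c a ha => ⟨fun i => by
    rw [smul_eq_C_mul]
    exact (degreeOf_C_mul_le _ _ _).trans (ha.1 i), fun i j => by
      simp only [Derivation.map_smul, mul_smul_comm, smul_mul_assoc, ha.2 i j]⟩

instance {ι K : Type*} [Field K] [Finite ι] (p q : ι → Polynomial K) (N : ℕ) :
    FiniteDimensional K (equalQuotients p q N) := by
  have hle : equalQuotients p q N ≤ restrictDegree ι K N := by
    intro h hh
    rw [mem_restrictDegree]
    intro s hs i
    exact (monomial_le_degreeOf i hs).trans (hh.1 i)
  exact Submodule.finiteDimensional_of_le hle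

/-- Invariance under `D`. Coprimality of `p a` and `p b` in distinct variables makes the quotient a
polynomial. -/
theorem exists_quotient_mem_equalQuotients {ι K : Type*} [Field K] [Nontrivial ι]
    {p q : ι → Polynomial K} (hp : ∀ i, p i ≠ 0)
    {N : ℕ} {h : MvPolynomial ι K}
    (hh : h ∈ equalQuotients p q N) :
    ∃ g ∈ equalQuotients p q N, ∀ i,
      Polynomial.aeval (X i : MvPolynomial ι K) (q i) * pderiv i h =
        Polynomial.aeval (X i : MvPolynomial ι K) (p i) * g := by
  obtain ⟨a, b, hab⟩ := exists_pair_ne ι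
  have hdvd : Polynomial.aeval (X a : MvPolynomial ι K) (p a) ∣
      Polynomial.aeval (X a : MvPolynomial ι K) (q a) * pderiv a h :=
    (isRelPrime_aeval_X hab (hp a) (hp b)).dvd_of_dvd_mul_right
      ⟨_, (hh.2 a b).trans (mul_comm _ _)⟩
  obtain ⟨g, hg⟩ := hdvd
  have key : ∀ i, Polynomial.aeval (X i : MvPolynomial ι K) (q i) * pderiv i h =
        Polynomial.aeval (X i : MvPolynomial ι K) (p i) * g := by
    intro i
    have h1 := hh.2 a i
    rw [hg] at h1
    refine mul_right_cancel₀ (aeval_X_ne_zero a (hp a)) ?_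
    rw [← h1]
    ring
  refine ⟨g, ⟨fun i => ?_, fun i j => ?_⟩, key⟩
  · by_cases hg0 : g = 0
    · simp [hg0]
    -- Computed with an index `j ≠ i`, the quotient cannot gain degree in `X i`: `p j` and `q j` do
    -- not involve it.
    obtain ⟨j, hj⟩ := exists_ne i
    have h1 := congrArg (degreeOf i) (key j)
    rw [degreeOf_mul_eq (aeval_X_ne_zero j (hp j)) hg0,
      degreeOf_aeval_X_of_ne hj.symm, zero_add] at h1
    rw [← h1]
    refine (degreeOf_mul_le _ _ _).trans ?_
    rw [degreeOf_aeval_X_of_ne hj.symm, zero_add]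
    exact (degreeOf_pderiv_le i j h).trans (hh.1 i)
  · rcases eq_or_ne i j with rfl | hij
    · rfl
    -- Both sides reduce to `q i * q j * ∂_i ∂_j h`, since `∂_j` treats `p i` and `q i` as
    -- constants.
    have h1 := congrArg (pderiv j) (key i)
    have h2 := congrArg (pderiv i) (key j)
    rw [pderiv_mul, pderiv_mul, pderiv_aeval_X_of_ne hij.symm,
      pderiv_aeval_X_of_ne hij.symm, zero_mul, zero_add, zero_mul, zero_add] at h1
    rw [pderiv_mul, pderiv_mul, pderiv_aeval_X_of_ne hij,
      pderiv_aeval_X_of_ne hij, zero_mul, zero_add, zero_mul, zero_add, pderiv_comm] at h2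
    linear_combination Polynomial.aeval (X j : MvPolynomial ι K) (q j) * h1 -
      Polynomial.aeval (X i : MvPolynomial ι K) (q i) * h2

theorem ratInVar_eq_div {d : ℕ} (r : RatFunc ℂ) (i : Fin d) :
    ratInVar r i = algebraMap _ (FractionRing (MvPolynomial (Fin d) ℂ))
        (Polynomial.aeval (X i : MvPolynomial (Fin d) ℂ) r.num) /
      algebraMap _ (FractionRing (MvPolynomial (Fin d) ℂ))
        (Polynomial.aeval (X i : MvPolynomial (Fin d) ℂ) r.denom) := by
  simp only [ratInVar, RatFunc.eval, ← Polynomial.aeval_def, Polynomial.aeval_algebraMap_apply]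

theorem mem_equalQuotients_of_partialQuot_eq {d : ℕ} {f : MvPolynomial (Fin d) ℂ}
    {r : Fin d → RatFunc ℂ} (hr : ∀ i, r i ≠ 0)
    (hf : ∀ i j, partialQuot f (r i) i = partialQuot f (r j) j) :
    f ∈ equalQuotients (fun i => (r i).num) (fun i => (r i).denom) f.totalDegree := by
  refine ⟨degreeOf_le_totalDegree f, fun i j => ?_⟩
  have h := hf i j
  have hne (s : Polynomial ℂ) (hs : s ≠ 0) (k : Fin d) :
      algebraMap _ (FractionRing (MvPolynomial (Fin d) ℂ))
        (Polynomial.aeval (X k : MvPolynomial (Fin d) ℂ) s) ≠ 0 :=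
    (map_ne_zero_iff _ (IsFractionRing.injective _ _)).mpr (aeval_X_ne_zero k hs)
  have hn (k : Fin d) := hne _ (RatFunc.num_ne_zero (hr k)) k
  simp only [partialQuot, ratInVar_eq_div] at h
  rw [div_div_eq_mul_div, div_div_eq_mul_div, div_eq_div_iff (hn i) (hn j)] at h
  apply IsFractionRing.injective _ (FractionRing (MvPolynomial (Fin d) ℂ))
  simp only [map_mul]
  linear_combination h

/-- A solution of the linear equation `F' = s' • A F` on `[0, 1]` is `exp ((s - s 0) • A) (F 0)`. -/
theorem eq_exp_smul_apply_of_hasDerivWithinAt {E : Type*} [NormedAddCommGroup E]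
    [NormedSpace ℂ E] [CompleteSpace E] (A : E →L[ℂ] E) {F : ℝ → E} {s s' : ℝ → ℂ}
    (hs : ∀ t ∈ I, HasDerivWithinAt s (s' t) I t)
    (hF : ∀ t ∈ I, HasDerivWithinAt F (s' t • A (F t)) I t) (h0 : s 0 = 0) :
    F 1 = NormedSpace.exp (s 1 • A) (F 0) := by
  have hexp (t : ℝ) (ht : t ∈ I) : HasDerivWithinAt (fun t => NormedSpace.exp (-s t • A))
      (-s' t • (NormedSpace.exp (-s t • A) * A)) I t :=
    HasDerivAt.scomp_hasDerivWithinAt (g₁ := fun u : ℂ => NormedSpace.exp (u • A)) (h := -s) t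
      (hasDerivAt_exp_smul_const A (-s t)) (hs t ht).neg
  -- Integrating factor: `exp (-s • A) F` is constant.
  have hG (t : ℝ) (ht : t ∈ I) :
      HasDerivWithinAt (fun t => NormedSpace.exp (-s t • A) (F t)) 0 I t := by
    let B : (E →L[ℂ] E) →L[ℝ] E →L[ℝ] E :=
      (ContinuousLinearMap.restrictScalarsL ℂ E E ℝ ℝ)
    have := (B.hasFDerivAt.comp_hasDerivWithinAt t (hexp t ht)).clm_apply (hF t ht)
    refine this.congr_deriv ?_
    simp [B]
  have hc := constant_of_derivWithin_zero (a := (0 : ℝ)) (b := 1)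
    (fun t ht => (hG t ht).differentiableWithinAt)
    (fun t ht => (hG t (Set.Ico_subset_Icc_self ht)).derivWithin
      (uniqueDiffOn_Icc_zero_one t (Set.Ico_subset_Icc_self ht))) 1 (Set.right_mem_Icc.mpr zero_le_one)
  simp only [h0, neg_zero, zero_smul, NormedSpace.exp_zero, one_apply_eq_self] at hc
  let _ : NormedAlgebra ℚ (E →L[ℂ] E) := NormedAlgebra.restrictScalars ℚ ℂ (E →L[ℂ] E)
  rw [← hc, ← mul_apply_eq_comp, ← NormedSpace.exp_add_of_commute]
  · simp
  · exact ((Commute.refl A).smul_left _).smul_right _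

theorem hasDerivWithinAt_eval_comp {ι : Type*} [Fintype ι] (h : MvPolynomial ι ℂ)
    {c : ι → ℝ → ℂ} {c' : ι → ℂ} {S : Set ℝ} {t : ℝ}
    (hc : ∀ i, HasDerivWithinAt (c i) (c' i) S t) :
    HasDerivWithinAt (fun t => eval (fun i => c i t) h)
      (∑ i, eval (fun i => c i t) (pderiv i h) * c' i) S t := by
  classical
  induction h using MvPolynomial.induction_on with
  | C a => simpa using hasDerivWithinAt_const t S a
  | add p q hp hq =>
    simp only [map_add, add_mul, Finset.sum_add_distrib]
    exact hp.add hq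
  | mul_X p k hp =>
    simp only [map_mul, eval_X]
    refine (hp.mul (hc k)).congr_deriv ?_
    simp only [Derivation.leibniz, smul_eq_mul, pderiv_X, map_add, map_mul, eval_X, add_mul,
      Finset.sum_add_distrib, Pi.single_apply, Finset.sum_mul]
    rw [add_comm]
    congr 1
    · simp [apply_ite (eval _)]
    · exact Finset.sum_congr rfl fun i _ => by ring

/-- The curve integral of `r(z) dz` up to time `t` is an antiderivative of its integrand. -/
theorem exists_antideriv_ratForm (r : RatFunc ℂ) {x : ℂ} (γ : Path (0 : ℂ) x)
    (hγ : ContDiffOn ℝ 1 γ.extend I) (hpole : ∀ t, ¬ IsPole r (γ t)) :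
    ∃ s : ℝ → ℂ, s 0 = 0 ∧ s 1 = ∫ᶜ z in γ, ratForm r z ∧ ∀ t ∈ I,
      HasDerivWithinAt s (r.eval (RingHom.id ℂ) (γ.extend t) * derivWithin γ.extend I t) I t := by
  set φ : ℝ → ℂ := fun t =>
    r.eval (RingHom.id ℂ) (γ.extend t) * derivWithin γ.extend I t with hφ
  have hcont : ContinuousOn φ I := by
    refine ContinuousOn.mul ?_ (hγ.continuousOn_derivWithin uniqueDiffOn_Icc_zero_one le_rfl)
    simp only [RatFunc.eval, Polynomial.eval₂_id]
    refine ContinuousOn.div ?_ ?_ fun t ht => ?_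
    · exact (r.num.continuous.comp γ.continuous_extend).continuousOn
    · exact (r.denom.continuous.comp γ.continuous_extend).continuousOn
    · have := hpole ⟨t, ht⟩
      rwa [IsPole, Polynomial.IsRoot.def, ← γ.extend_apply ht] at this
  refine ⟨fun t => ∫ u in (0 : ℝ)..t, φ u, by simp, ?_, fun t ht => ?_⟩
  · simp [curveIntegral_def, curveIntegralFun_def, ratForm, hφ]
  · have : Fact (t ∈ Set.Icc (0 : ℝ) 1) := ⟨ht⟩
    refine intervalIntegral.integral_hasDerivWithinAt_right ?_ (s := I) (t := I) ?_ (hcont t ht)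
    · exact (hcont.mono (by
        rw [Set.uIcc_of_le ht.1]; exact Set.Icc_subset_Icc_right ht.2)).intervalIntegrable
    · exact hcont.stronglyMeasurableAtFilter_nhdsWithin measurableSet_Icc t

theorem theorem5p2 (d : ℕ) (hd : 2 ≤ d) (f : MvPolynomial (Fin d) ℂ) (r : Fin d → RatFunc ℂ)
    (hr : ∀ i, r i ≠ 0)
    (hf : ∀ i j, partialQuot f (r i) i = partialQuot f (r j) j) :
    ∃ H : ℂ → ℂ, Differentiable ℂ H ∧
      ∀ (x : Fin d → ℂ) (γ : ∀ i, Path (0 : ℂ) (x i)),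
        (∀ i, ContDiffOn ℝ 1 (γ i).extend I) →
        (∀ i t, ¬ IsPole (r i) (γ i t)) →
        MvPolynomial.eval x f = H (∑ i, ∫ᶜ z in γ i, ratForm (r i) z) := by
  have : Nontrivial (Fin d) := Fin.nontrivial_iff_two_le.mpr hd
  let p : Fin d → Polynomial ℂ := fun i => (r i).num
  let q : Fin d → Polynomial ℂ := fun i => (r i).denom
  let W := equalQuotients p q f.totalDegree
  let b := Module.finBasis ℂ W
  choose g hgW hg using fun k => exists_quotient_mem_equalQuotients
    (fun i => RatFunc.num_ne_zero (hr i)) (b k).2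
  -- Row `k` holds the coordinates of `D (b k)`.
  let M : Matrix (Fin (Module.finrank ℂ W)) (Fin (Module.finrank ℂ W)) ℂ :=
    fun k l => b.repr ⟨g k, hgW k⟩ l
  let A : (Fin (Module.finrank ℂ W) → ℂ) →L[ℂ] (Fin (Module.finrank ℂ W) → ℂ) :=
    LinearMap.toContinuousLinearMap M.mulVecLin
  have hexpand (h : W) (y : Fin d → ℂ) :
      eval y (h : MvPolynomial (Fin d) ℂ) =
        ∑ k, b.repr h k * eval y (b k : MvPolynomial (Fin d) ℂ) := by
    have h1 := congrArg (fun w : W => eval y (w : MvPolynomial (Fin d) ℂ)) (b.sum_repr h)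
    simp only [Submodule.coe_sum, Submodule.coe_smul, map_sum, smul_eval] at h1
    exact h1.symm
  let f' : W := ⟨f, mem_equalQuotients_of_partialQuot_eq hr hf⟩
  let v : Fin (Module.finrank ℂ W) → ℂ := fun k => eval 0 (b k : MvPolynomial (Fin d) ℂ)
  refine ⟨fun s => ∑ k, b.repr f' k * NormedSpace.exp (s • A) v k, ?_, fun x γ hγ hpole => ?_⟩
  · refine Differentiable.fun_sum fun k _ => Differentiable.const_mul ?_ _
    have h1 : Differentiable ℂ fun s : ℂ => NormedSpace.exp (s • A) v := fun s =>
      ((hasDerivAt_exp_smul_const A s).clm_apply (hasDerivAt_const s v)).differentiableAt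
    exact differentiable_pi.mp h1 k
  choose s hs0 hs1 hs using fun i => exists_antideriv_ratForm (r i) (γ i) (hγ i) (hpole i)
  let F : ℝ → Fin (Module.finrank ℂ W) → ℂ := fun t k =>
    eval (fun i => (γ i).extend t) (b k : MvPolynomial (Fin d) ℂ)
  have hF : ∀ t ∈ I, HasDerivWithinAt F ((∑ i, (r i).eval (RingHom.id ℂ) ((γ i).extend t) *
      derivWithin (γ i).extend I t) • A (F t)) I t := by
    intro t ht
    refine hasDerivWithinAt_pi.mpr fun k => ?_
    refine (hasDerivWithinAt_eval_comp _ fun i =>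
      ((hγ i).differentiableOn one_ne_zero t ht).hasDerivWithinAt).congr_deriv ?_
    have hA : A (F t) k = eval (fun i => (γ i).extend t) (g k) := (hexpand ⟨g k, hgW k⟩ _).symm
    rw [Pi.smul_apply, hA, smul_eq_mul, Finset.sum_mul]
    refine Finset.sum_congr rfl fun i _ => ?_
    have hev (u : Polynomial ℂ) : eval (fun i => (γ i).extend t)
        (Polynomial.aeval (X i : MvPolynomial (Fin d) ℂ) u) = u.eval ((γ i).extend t) := by
      rw [← MvPolynomial.coe_aeval_eq_eval, RingHom.coe_coe, ← Polynomial.aeval_algHom_apply]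
      simp
    have hq0 : (r i).denom.eval ((γ i).extend t) ≠ 0 := by
      rw [(γ i).extend_apply ht]
      exact hpole i ⟨t, ht⟩
    have h1 := congrArg (eval fun i => (γ i).extend t) (hg k i)
    rw [map_mul, map_mul, hev, hev] at h1
    rw [RatFunc.eval, Polynomial.eval₂_id, Polynomial.eval₂_id]
    field_simp
    linear_combination derivWithin (γ i).extend I t * h1
  have hmain := eq_exp_smul_apply_of_hasDerivWithinAt A (s := fun t => ∑ i, s i t)
    (fun t ht => HasDerivWithinAt.fun_sum fun i _ => hs i t ht) hF (by simp [hs0])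
  have hF0 : F 0 = v := by
    ext k
    simp only [F, v, Path.extend_zero]
    rfl
  have hF1 (k) : F 1 k = eval x (b k : MvPolynomial (Fin d) ℂ) := by
    simp only [F, Path.extend_one]
  simp only [hs1, hF0] at hmain
  beta_reduce
  rw [← hmain]
  simpa only [hF1] using hexpand f' x
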